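/- Let $n\ge 2$, let $I\subset\mathbb{R}$ be an open set of times (for instance an open interval), and let $\Omega_t\subset\mathbb{R}^n$, $t\in I$, be connected open sets with nonempty boundary $\Gamma_t=\partial\Omega_t$. Assume that the boundary is nonsingular and real-analytic with analytic time-dependence: near each point $(t,x)$, $t\in I$, of the boundary of the space-time region $\{(t,x):t\in I,\ x\in\Omega_t\}$ this region has the form $\{\varphi<0\}$ with $\varphi$ real-analytic and $\nabla_x\varphi\ne0$ at $(t,x)$. The normal velocity of $\Gamma_t$ is then the vector $v_n=-\frac{\partial_t\varphi}{\|\nabla_x\varphi\|^2}\nabla_x\varphi$. Let the filtration $\lambda$ and the porosity $\rho$ be functions that are real-analytic (in a neighborhood of each point) and positive on $\overline{\Omega_t}$ for each $t\in I$. Let $q$ be of class $C^2$ near $\Gamma_t$ with $\mathrm{div}(\lambda\rho\nabla q)=n\rho$ near $\Gamma_t$, for each $t\in I$. Let $u(x,t)$ be the generalized Schwarz potential of $\Gamma_t$: it is real-analytic in $(x,t)$ near $\{(x,t):t\in I,\ x\in\Gamma_t\}$, and for each $t\in I$ it solves the Cauchy problem $$\mathrm{div}(\lambda\rho\nabla u)=0\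 \text{ near }\Gamma_t,\qquad u=q\ \text{ and }\ \nabla u=\nabla q\ \text{ on }\Gamma_t .$$ Let $S$ be a finite set of sinks contained in every $\Omega_t$ (a single sink being the basic case), with rates $Q_s(t)\neq0$, $s\in S$ (sources for $Q_s<0$), and let $P(x,t)$ be a function such that, for each $t\in I$, $P(\cdot,t)$ is real-analytic in $\Omega_t\setminus S$ and has at each $s\in S$ a singularity of the type of the fundamental solution of the operator $\mathrm{div}(\lambda\rho\nabla\,\cdot\,)$, namely $$P(x,t)\sim -Q_s(t)\,\frac{K(x-s)}{\lambda(s)\rho(s)}\qquad (x\to s),$$ where $K$ is the fundamental solution of the Laplace equation with $-\Delta K=\delta_0$, that is $K(x)=-\frac1{2\pi}\log\|x\|$ for $n=2$ and $K(x)=\frac{1}{(n-2)\omega_n}\|x\|^{2-n}$ for $n\ge3$, with $\omega_n$ the area of the unit sphere. The family $\Omega_t$ is called an elliptic growth (with filtration $\lambda$, porosity $\rho$ and these sinks) with pressure $P$ if, for each $t\in I$, $\mathrm{div}(\lambda\rho\nabla P)=0$ in $\Omega_t\setminus S$, $P(\cdot,t)$ is real-analytic in a neighborhood of each point of $\Gamma_t$,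 $P=0$ on $\Gamma_t$, and $v_n=-\lambda\nabla P$ on $\Gamma_t$. Then $\Omega_t$, $t\in I$, is an elliptic growth with pressure $P$ if and only if, for each $t\in I$, $$\frac{\partial u}{\partial t}(x,t)=-n\,P(x,t)\qquad\text{for all } x \text{ in a neighborhood of } \Gamma_t .$$ -/

import Mathlib

open Set Filter Topology Asymptotics MeasureTheory

noncomputable section

namespace EllipticGrowth

/-- Euclidean space of dimension `n`. -/
abbrev E (n : ℕ) : Type := EuclideanSpace ℝ (Fin n)

/-- The divergence `∑ i, ∂ Fᵢ / ∂ xᵢ` of a vector field. -/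
def divergence {n : ℕ} (F : E n → E n) (x : E n) : ℝ :=
  ∑ i : Fin n, (fderiv ℝ F x (EuclideanSpace.single i 1)) i

/-- The operator `f ↦ div (lam * rho * ∇ f)`. -/
def ellipticOp {n : ℕ} (lam rho f : E n → ℝ) (x : E n) : ℝ :=
  divergence (fun y => (lam y * rho y) • gradient f y) x

/-- The fundamental solution `K` of the Laplace equation with the sign `-Δ K = δ₀`, so that
`K → +∞` at the origin: `K x = -log ‖x‖ / (2 π)` if `n = 2`, and otherwise
`K x = ‖x‖ ^ (2 - n) / ((n - 2) ω)`, with `ω = n * vol (unit ball)` the area of the unit sphere. -/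
def fundSol (n : ℕ) (x : E n) : ℝ :=
  if n = 2 then -Real.log ‖x‖ / (2 * Real.pi)
  else ‖x‖ ^ (2 - (n : ℤ)) /
    (((n : ℝ) - 2) * ((n : ℝ) * (volume : Measure (E n)).real (Metric.ball 0 1)))

/-- `φ` is a real-analytic local defining function of the moving domain `Om` near time `t` and
position `x`: near `(t, x)` the domain is `{φ < 0}`, and the spatial gradient of `φ` does not
vanish at `(t, x)`. -/
def IsLocalDefiningFunction {n : ℕ} (Om : ℝ → Set (E n)) (φ : ℝ × E n → ℝ)
    (t : ℝ) (x : E n) : Prop :=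
  AnalyticAt ℝ φ (t, x) ∧
  gradient (fun y => φ (t, y)) x ≠ 0 ∧
  ∀ᶠ p : ℝ × E n in 𝓝 (t, x), p.2 ∈ Om p.1 ↔ φ p < 0

/-- A one-parameter family of domains `Om t`, `t ∈ I`, in `ℝⁿ`, with (nonempty, nonsingular)
real-analytic boundary which also depends analytically on time. The last field is about all points
of the boundary of the space-time region that lie over `I`; these include every point of
`∂ (Om t)`, and no part of the boundary can appear or disappear suddenly. -/
structure IsAnalyticMovingDomain {n : ℕ} (I : Set ℝ) (Om : ℝ → Set (E n)) : Prop where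
  isOpen : ∀ t ∈ I, IsOpen (Om t)
  isConnected : ∀ t ∈ I, IsConnected (Om t)
  frontier_nonempty : ∀ t ∈ I, (frontier (Om t)).Nonempty
  analytic_boundary : ∀ t ∈ I, ∀ x : E n,
    (t, x) ∈ frontier {p : ℝ × E n | p.1 ∈ I ∧ p.2 ∈ Om p.1} →
      ∃ φ : ℝ × E n → ℝ, IsLocalDefiningFunction Om φ t x

/-- The boundary of the moving domain `Om` has (vectorial, outward if expanding) normal velocity
`v` at time `t` and position `x`: with a local defining function `φ`, this is
`v = - (∂ₜ φ / ‖∇ φ‖ ²) ∇ φ`. -/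
def HasNormalVelocity {n : ℕ} (Om : ℝ → Set (E n)) (t : ℝ) (x v : E n) : Prop :=
  ∃ φ : ℝ × E n → ℝ, IsLocalDefiningFunction Om φ t x ∧
    v = -(deriv (fun s => φ (s, x)) t / ‖gradient (fun y => φ (t, y)) x‖ ^ 2) •
      gradient (fun y => φ (t, y)) x

/-- `p` is real-analytic in the domain `D`, except at the finitely many sinks
`s ∈ S ⊆ D`, where it has a singularity of the same type as the fundamental solution of
`div (lam * rho * ∇ p) = 0`, of strength `-Q s`: since the leading coefficient at `s` is
`lam s * rho s`, this means `p x ∼ -Q s * K (x - s) / (lam s * rho s)` as `x → s`. -/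
structure HasSinks {n : ℕ} (lam rho : E n → ℝ) (D : Set (E n)) (S : Finset (E n))
    (Q : E n → ℝ) (p : E n → ℝ) : Prop where
  subset : (S : Set (E n)) ⊆ D
  analytic : AnalyticOnNhd ℝ p (D \ (S : Set (E n)))
  singularity : ∀ s ∈ S,
    p ~[𝓝[≠] s] fun x => -Q s * (fundSol n (x - s) / (lam s * rho s))

/-- The moving domain `Om t`, `t ∈ I`, is an elliptic growth with filtration `lam`, porosity `rho`,
pressure `P`, and sinks (or sources) `s ∈ S` of strength `Q t s`. The pressure is a classical
solution in the analytic category: it is analytic up to the (analytic) boundary, so that its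
boundary values and boundary gradient make sense. -/
structure IsEllipticGrowth {n : ℕ} (I : Set ℝ) (lam rho : E n → ℝ) (S : Finset (E n))
    (Q : ℝ → E n → ℝ) (Om : ℝ → Set (E n)) (P : ℝ → E n → ℝ) : Prop where
  sinks : ∀ t ∈ I, HasSinks lam rho (Om t) S (Q t) (P t)
  pde : ∀ t ∈ I, ∀ x ∈ Om t \ (S : Set (E n)), ellipticOp lam rho (P t) x = 0
  regular : ∀ t ∈ I, AnalyticOnNhd ℝ (P t) (frontier (Om t))
  boundary : ∀ t ∈ I, ∀ x ∈ frontier (Om t), P t x = 0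
  darcy : ∀ t ∈ I, ∀ x ∈ frontier (Om t),
    HasNormalVelocity Om t x (-(lam x • gradient (P t) x))

/-- `w` solves, near the hypersurface `Γ`, the Cauchy problem `div (lam * rho * ∇ w) = 0` with
`w = q` and `∇ w = ∇ q` on `Γ`. -/
structure IsGeneralizedSchwarzPotential {n : ℕ} (lam rho q : E n → ℝ) (Γ : Set (E n))
    (w : E n → ℝ) : Prop where
  analytic : AnalyticOnNhd ℝ w Γ
  pde : ∀ᶠ x in 𝓝ˢ Γ, ellipticOp lam rho w x = 0
  value : ∀ x ∈ Γ, w x = q x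
  grad : ∀ x ∈ Γ, gradient w x = gradient q x

end EllipticGrowth

end

namespace EllipticGrowth

/-! Both directions compare `∂u/∂t` with `-n P` through their Cauchy data on `Γ_t`.

The key computation is `deriv_schwarzPotential`. In space-time, `W = u - q` and its spatial gradient
vanish on the moving boundary `φ = 0`. A function vanishing there has differential parallel to `dφ`.
For `W` this gives `∂u/∂t = 0` on the boundary. For each `∂ᵢW` it makes the spatial Hessian a
multiple of `∇φ ⊗ ∇φ` and expresses `∂ₜ∂ᵢW` through it. The two equations give this Hessian trace
`-n/λ`, so `∇(∂u/∂t) = (n/λ) v_n` on `Γ_t`. Darcy's law `v_n = -λ∇P` is therefore the same as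
`∇(∂u/∂t) = -n∇P` there. Since `λρ` does not depend on time, `∂u/∂t` solves the same elliptic
equation (`eventually_expandedOp_deriv_eq_zero`).

For an elliptic growth, `∂u/∂t` and `-nP` thus solve one Cauchy problem and agree by uniqueness
(`eventually_eq_zero_of_cauchy`). Conversely, the identity transfers analyticity, the boundary
conditions and the equation to `P` near `Γ_t`. The equation then spreads over `Ω_t \ S`, which is
connected because `n ≥ 2`, by the identity theorem. -/

/-- The derivative of `f` in the direction of the constant vector `v`. -/
noncomputable def dirDeriv {V : Type*} [NormedAddCommGroup V] [NormedSpace ℝ V] (v : V) (f : V → ℝ) :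
    V → ℝ :=
  fun y => fderiv ℝ f y v

/-! ### Calculus of directional derivatives -/

section DirDeriv

variable {V : Type*} [NormedAddCommGroup V] [NormedSpace ℝ V] {f g : V → ℝ} {x : V}

theorem analyticAt_dirDeriv (hf : AnalyticAt ℝ f x) (v : V) : AnalyticAt ℝ (dirDeriv v f) x :=
  ((ContinuousLinearMap.apply ℝ ℝ v).analyticAt _).comp hf.fderiv

theorem dirDeriv_congr (h : f =ᶠ[𝓝 x] g) (v : V) : dirDeriv v f =ᶠ[𝓝 x] dirDeriv v g :=
  h.fderiv.fun_comp fun L : V →L[ℝ] ℝ => L v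

theorem contDiffAt_dirDeriv (hf : ContDiffAt ℝ 2 f x) (v : V) : ContDiffAt ℝ 1 (dirDeriv v f) x :=
  (hf.fderiv_right (m := 1) (by norm_num)).clm_apply contDiffAt_const

theorem dirDeriv_dirDeriv_apply (hf : ContDiffAt ℝ 2 f x) (v w : V) :
    dirDeriv v (dirDeriv w f) x = fderiv ℝ (fderiv ℝ f) x v w := by
  have h : DifferentiableAt ℝ (fderiv ℝ f) x :=
    (hf.fderiv_right (m := 1) (by norm_num)).differentiableAt (by norm_num)
  have := (h.hasFDerivAt.clm_apply (hasFDerivAt_const w x)).fderiv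
  change fderiv ℝ (fun y => fderiv ℝ f y w) x v = _
  simp [this]

theorem dirDeriv_comm_apply (hf : ContDiffAt ℝ 2 f x) (v w : V) :
    dirDeriv v (dirDeriv w f) x = dirDeriv w (dirDeriv v f) x := by
  rw [dirDeriv_dirDeriv_apply hf, dirDeriv_dirDeriv_apply hf]
  exact hf.isSymmSndFDerivAt (by simp) v w

theorem dirDeriv_comm (hf : AnalyticAt ℝ f x) (v w : V) :
    dirDeriv v (dirDeriv w f) =ᶠ[𝓝 x] dirDeriv w (dirDeriv v f) :=
  hf.eventually_analyticAt.mono fun _ hy => dirDeriv_comm_apply hy.contDiffAt v w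

theorem dirDeriv_add_apply (hf : DifferentiableAt ℝ f x) (hg : DifferentiableAt ℝ g x) (v : V) :
    dirDeriv v (f + g) x = dirDeriv v f x + dirDeriv v g x := by
  simp [dirDeriv, fderiv_add hf hg]

theorem dirDeriv_mul_apply (hf : DifferentiableAt ℝ f x) (hg : DifferentiableAt ℝ g x) (v : V) :
    dirDeriv v (f * g) x = f x * dirDeriv v g x + dirDeriv v f x * g x := by
  simp [dirDeriv, fderiv_mul hf hg]
  ring

theorem dirDeriv_sub_apply (hf : DifferentiableAt ℝ f x) (hg : DifferentiableAt ℝ g x) (v : V) :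
    dirDeriv v (f - g) x = dirDeriv v f x - dirDeriv v g x := by
  simp [dirDeriv, fderiv_sub hf hg]

theorem dirDeriv_add (hf : AnalyticAt ℝ f x) (hg : AnalyticAt ℝ g x) (v : V) :
    dirDeriv v (f + g) =ᶠ[𝓝 x] dirDeriv v f + dirDeriv v g := by
  filter_upwards [hf.eventually_analyticAt, hg.eventually_analyticAt] with y hy hy'
  exact dirDeriv_add_apply hy.differentiableAt hy'.differentiableAt v

theorem dirDeriv_mul (hf : AnalyticAt ℝ f x) (hg : AnalyticAt ℝ g x) (v : V) :
    dirDeriv v (f * g) =ᶠ[𝓝 x] f * dirDeriv v g + dirDeriv v f * g := by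
  filter_upwards [hf.eventually_analyticAt, hg.eventually_analyticAt] with y hy hy'
  exact dirDeriv_mul_apply hy.differentiableAt hy'.differentiableAt v

theorem dirDeriv_sum_apply {ι : Type*} (s : Finset ι) {F : ι → V → ℝ}
    (hF : ∀ i ∈ s, DifferentiableAt ℝ (F i) x) (v : V) :
    dirDeriv v (fun y => ∑ i ∈ s, F i y) x = ∑ i ∈ s, dirDeriv v (F i) x := by
  simp [dirDeriv, fderiv_fun_sum hF]

theorem dirDeriv_eq_zero_of_eventuallyEq_zero (h : ∀ᶠ y in 𝓝 x, f y = 0) (v : V) :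
    dirDeriv v f x = 0 := by
  have h' : f =ᶠ[𝓝 x] fun _ => (0 : ℝ) := h
  simp [dirDeriv, h'.fderiv_eq]

/-- Peels one derivative off the diagonal of the Taylor coefficient, matching the recursion in
`VanishOrder`. -/
theorem iteratedFDeriv_succ_apply_const (hf : AnalyticAt ℝ f x) (k : ℕ) (v : V) :
    iteratedFDeriv ℝ (k + 1) f x (fun _ => v) =
      iteratedFDeriv ℝ k (dirDeriv v f) x (fun _ => v) := by
  rw [iteratedFDeriv_succ_apply_right]
  have := (ContinuousLinearMap.apply ℝ ℝ v).iteratedFDeriv_comp_left (i := k) (n := k)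
    (hf.fderiv.contDiffAt) le_rfl
  change _ = (iteratedFDeriv ℝ k ((ContinuousLinearMap.apply ℝ ℝ v) ∘ fderiv ℝ f) x) _
  rw [this]
  rfl

/-- If `f` vanishes on the hypersurface `ψ = 0`, then the differential of `f` is parallel to that of
`ψ`. -/
theorem fderiv_parallel [CompleteSpace V] {ψ : V → ℝ} (hf : ContDiffAt ℝ 1 f x)
    (hψ : ContDiffAt ℝ 1 ψ x) (h0 : ψ x = 0) (h : ∀ᶠ y in 𝓝 x, ψ y = 0 → f y = 0) (v w : V) :
    dirDeriv v f x * dirDeriv w ψ x = dirDeriv w f x * dirDeriv v ψ x := by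
  -- `f` is constant on the level set, so `x` is trivially a constrained extremum and Lagrange
  -- multipliers give a linear relation between the differentials. No regularity of `ψ` is needed:
  -- if the multiplier of `f` is zero, then `dψ = 0` and both sides vanish.
  have hext : IsLocalExtrOn f {y | ψ y = ψ x} x := by
    left
    have hx : f x = 0 := h.self_of_nhds h0
    refine eventually_nhdsWithin_iff.2 (h.mono fun y hy hy' => ?_)
    rw [hx, hy (by rw [← h0]; exact hy')]
  obtain ⟨a, b, hab, e⟩ := hext.exists_multipliers_of_hasStrictFDerivAt_1d
    (hψ.hasStrictFDerivAt (by norm_num)) (hf.hasStrictFDerivAt (by norm_num))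
  have e1 : a * dirDeriv v ψ x + b * dirDeriv v f x = 0 := by
    simpa [dirDeriv] using congrArg (fun L : V →L[ℝ] ℝ => L v) e
  have e2 : a * dirDeriv w ψ x + b * dirDeriv w f x = 0 := by
    simpa [dirDeriv] using congrArg (fun L : V →L[ℝ] ℝ => L w) e
  by_cases hb : b = 0
  · have ha : a ≠ 0 := fun ha => hab (by simp [ha, hb])
    simp [hb, ha] at e1 e2
    simp [e1, e2]
  · refine mul_left_cancel₀ hb ?_
    linear_combination dirDeriv w ψ x * e1 - dirDeriv v ψ x * e2

end DirDeriv

/-! ### Order of vanishing along a hypersurface -/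

section VanishOrder

variable {V : Type*} [NormedAddCommGroup V] [NormedSpace ℝ V] {f g ψ : V → ℝ} {x : V}

/-- The analytic function `f` vanishes, along with its derivatives of order `< k`, on the
hypersurface `ψ = 0` near the point `x`. -/
def VanishOrder (ψ : V → ℝ) (x : V) : ℕ → (V → ℝ) → Prop
  | 0, f => AnalyticAt ℝ f x
  | k + 1, f => AnalyticAt ℝ f x ∧ (∀ᶠ y in 𝓝 x, ψ y = 0 → f y = 0) ∧
      ∀ v, VanishOrder ψ x k (dirDeriv v f)

namespace VanishOrder

theorem analyticAt {k : ℕ} (h : VanishOrder ψ x k f) : AnalyticAt ℝ f x := by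
  cases k with
  | zero => exact h
  | succ k => exact h.1

theorem congr {k : ℕ} : ∀ {f g : V → ℝ}, VanishOrder ψ x k f → f =ᶠ[𝓝 x] g →
    VanishOrder ψ x k g := by
  induction k with
  | zero => exact fun h e => AnalyticAt.congr h e
  | succ k ih =>
    refine fun h e => ⟨h.1.congr e, ?_, fun v => ih (h.2.2 v) (dirDeriv_congr e v)⟩
    filter_upwards [h.2.1, e] with y hy hy' h0
    rw [← hy', hy h0]

theorem of_succ {k : ℕ} : ∀ {f : V → ℝ}, VanishOrder ψ x (k + 1) f → VanishOrder ψ x k f := by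
  induction k with
  | zero => exact fun h => h.1
  | succ k ih => exact fun h => ⟨h.1, h.2.1, fun v => ih (h.2.2 v)⟩

theorem add {k : ℕ} : ∀ {f g : V → ℝ}, VanishOrder ψ x k f → VanishOrder ψ x k g →
    VanishOrder ψ x k (f + g) := by
  induction k with
  | zero => exact fun hf hg => AnalyticAt.add hf hg
  | succ k ih =>
    refine fun hf hg => ⟨hf.1.add hg.1, ?_, fun v =>
      (ih (hf.2.2 v) (hg.2.2 v)).congr (dirDeriv_add hf.1 hg.1 v).symm⟩
    filter_upwards [hf.2.1, hg.2.1] with y hy hy' h0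
    simp [hy h0, hy' h0]

theorem mul_left {k : ℕ} : ∀ {a f : V → ℝ}, AnalyticAt ℝ a x → VanishOrder ψ x k f →
    VanishOrder ψ x k (a * f) := by
  induction k with
  | zero => exact fun ha hf => AnalyticAt.mul ha hf
  | succ k ih =>
    refine fun ha hf => ⟨ha.mul hf.1, ?_, fun v =>
      ((ih ha (hf.2.2 v)).add (ih (analyticAt_dirDeriv ha v) hf.of_succ)).congr
        (dirDeriv_mul ha hf.1 v).symm⟩
    filter_upwards [hf.2.1] with y hy h0
    simp [hy h0]

theorem neg {k : ℕ} (h : VanishOrder ψ x k f) : VanishOrder ψ x k (-f) :=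
  (mul_left (analyticAt_const (v := (-1 : ℝ))) h).congr (by
    filter_upwards with y; simp)

theorem sub {k : ℕ} (hf : VanishOrder ψ x k f) (hg : VanishOrder ψ x k g) :
    VanishOrder ψ x k (f - g) := by
  rw [sub_eq_add_neg]
  exact hf.add hg.neg

theorem sum {ι : Type*} {k : ℕ} (s : Finset ι) {F : ι → V → ℝ}
    (h : ∀ i ∈ s, VanishOrder ψ x k (F i)) : VanishOrder ψ x k (∑ i ∈ s, F i) := by
  classical
  induction s using Finset.induction_on with
  | empty =>
    clear h
    simp only [Finset.sum_empty]
    induction k with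
    | zero => exact analyticAt_const
    | succ k ih =>
      refine ⟨analyticAt_const, by simp, fun v => ?_⟩
      have : dirDeriv v (0 : V → ℝ) = 0 := by
        ext y
        simp [dirDeriv]
      rwa [this]
  | insert i s hi ih =>
    rw [Finset.sum_insert hi]
    exact (h i (by simp)).add (ih fun j hj => h j (by simp [hj]))

theorem of_mul_left {k : ℕ} {a : V → ℝ} (ha : AnalyticAt ℝ a x) (h0 : a x ≠ 0)
    (h : VanishOrder ψ x k (a * f)) : VanishOrder ψ x k f :=
  (mul_left (ha.inv h0) h).congr <| by
    filter_upwards [ha.continuousAt.eventually_ne h0] with y hy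
    simp [hy]

/-- Differentiation along a field tangent to `ψ = 0` preserves the order of vanishing on
`ψ = 0`. -/
theorem tangent [CompleteSpace V] {k : ℕ} (hψ : AnalyticAt ℝ ψ x) (v w : V) :
    ∀ {f : V → ℝ}, VanishOrder ψ x k f →
      VanishOrder ψ x k (dirDeriv w ψ * dirDeriv v f - dirDeriv v ψ * dirDeriv w f) := by
  induction k with
  | zero =>
    exact fun hf => ((analyticAt_dirDeriv hψ w).mul (analyticAt_dirDeriv hf v)).sub
      ((analyticAt_dirDeriv hψ v).mul (analyticAt_dirDeriv hf w))
  | succ k ih =>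
    intro f hf
    have hψd := analyticAt_dirDeriv hψ
    have hfd := analyticAt_dirDeriv hf.1
    refine ⟨((hψd w).mul (hfd v)).sub ((hψd v).mul (hfd w)), ?_, fun z => ?_⟩
    · filter_upwards [hf.2.1.eventually_nhds, hf.1.eventually_analyticAt,
        hψ.eventually_analyticAt] with y h1 h2 h3 h0
      have := fderiv_parallel h2.contDiffAt h3.contDiffAt h0 h1 v w
      simp only [Pi.sub_apply, Pi.mul_apply]
      linarith
    -- Commuting `∂_z` past the tangential field leaves the field applied to `∂_z f`, plus first
    -- derivatives of `f` with analytic coefficients; all of these vanish to order `k`.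
    · refine (((ih (hf.2.2 z)).add (mul_left (analyticAt_dirDeriv (hψd w) z) (hf.2.2 v))).sub
        (mul_left (analyticAt_dirDeriv (hψd v) z) (hf.2.2 w))).congr ?_
      filter_upwards [dirDeriv_comm hf.1 v z, dirDeriv_comm hf.1 w z,
        (hψd w).eventually_analyticAt, (hψd v).eventually_analyticAt,
        (hfd w).eventually_analyticAt, (hfd v).eventually_analyticAt] with y h1 h2 h3 h4 h5 h6
      rw [dirDeriv_sub_apply (h3.mul h6).differentiableAt (h4.mul h5).differentiableAt,
        dirDeriv_mul_apply h3.differentiableAt h6.differentiableAt,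
        dirDeriv_mul_apply h4.differentiableAt h5.differentiableAt]
      simp only [Pi.sub_apply, Pi.mul_apply, Pi.add_apply, h1, h2]
      ring

/-- Every derivative of `f` at `x` vanishes on the diagonal, which is all that the Taylor series
sees. Order `k + 1` is what controls the `k`-th derivative. -/
theorem eventually_eq_zero (h0 : ψ x = 0) (h : ∀ k, VanishOrder ψ x k f) :
    ∀ᶠ y in 𝓝 x, f y = 0 := by
  have key : ∀ (k : ℕ) (f : V → ℝ), VanishOrder ψ x (k + 1) f → ∀ v : V,
      iteratedFDeriv ℝ k f x (fun _ => v) = 0 := by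
    intro k
    induction k with
    | zero => exact fun f hf v => by simpa using hf.2.1.self_of_nhds h0
    | succ k ih =>
      intro f hf v
      rw [iteratedFDeriv_succ_apply_const hf.1]
      exact ih _ (hf.2.2 v) v
  obtain ⟨p, r, hp⟩ := (h 0).analyticAt
  filter_upwards [Metric.eball_mem_nhds x hp.r_pos] with y hy
  have hs := hp.hasSum_iteratedFDeriv (y := y - x) (by
    simpa [edist_eq_enorm_sub] using hy)
  simp only [key _ f (h _), smul_zero, add_sub_cancel] at hs
  exact hs.unique hasSum_zero

end VanishOrder

end VanishOrder
-- The elliptic operator and uniqueness in the Cauchy problem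
/-- The operator `f ↦ ∑ i, ∂ᵢ (κ ∂ᵢ f)` in nondivergence form, where `∂ᵢ` is the derivative in the
direction `e i`. -/
noncomputable def expandedOp {V ι : Type*} [NormedAddCommGroup V] [NormedSpace ℝ V] [Fintype ι]
    (e : ι → V) (κ f : V → ℝ) (y : V) : ℝ :=
  ∑ i, (κ y * dirDeriv (e i) (dirDeriv (e i) f) y + dirDeriv (e i) κ y * dirDeriv (e i) f y)

section ExpandedOp

variable {V ι : Type*} [NormedAddCommGroup V] [NormedSpace ℝ V] [Fintype ι] {e : ι → V}
  {κ f g ψ : V → ℝ} {x : V}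

theorem analyticAt_expandedOp (hκ : AnalyticAt ℝ κ x) (hf : AnalyticAt ℝ f x) :
    AnalyticAt ℝ (expandedOp e κ f) x := by
  unfold expandedOp
  refine Finset.analyticAt_fun_sum _ fun i _ => ?_
  exact (hκ.mul (analyticAt_dirDeriv (analyticAt_dirDeriv hf _) _)).add
    ((analyticAt_dirDeriv hκ _).mul (analyticAt_dirDeriv hf _))

theorem expandedOp_congr (h : f =ᶠ[𝓝 x] g) : expandedOp e κ f =ᶠ[𝓝 x] expandedOp e κ g := by
  have h1 : ∀ᶠ y in 𝓝 x, ∀ i, dirDeriv (e i) f y = dirDeriv (e i) g y :=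
    eventually_all.2 fun i => dirDeriv_congr h _
  have h2 : ∀ᶠ y in 𝓝 x, ∀ i,
      dirDeriv (e i) (dirDeriv (e i) f) y = dirDeriv (e i) (dirDeriv (e i) g) y :=
    eventually_all.2 fun i => dirDeriv_congr (dirDeriv_congr h _) _
  filter_upwards [h1, h2] with y h1 h2
  simp [expandedOp, h1, h2]

theorem expandedOp_sub_apply (hf : ContDiffAt ℝ 2 f x) (hg : ContDiffAt ℝ 2 g x) :
    expandedOp e κ (f - g) x = expandedOp e κ f x - expandedOp e κ g x := by
  have h1 : ∀ i, dirDeriv (e i) (f - g) =ᶠ[𝓝 x] dirDeriv (e i) f - dirDeriv (e i) g := by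
    intro i
    filter_upwards [hf.eventually (by simp), hg.eventually (by simp)] with y hy hy'
    exact dirDeriv_sub_apply (hy.differentiableAt (by norm_num))
      (hy'.differentiableAt (by norm_num)) _
  simp only [expandedOp, ← Finset.sum_sub_distrib]
  refine Finset.sum_congr rfl fun i _ => ?_
  rw [(h1 i).self_of_nhds, (dirDeriv_congr (h1 i) (e i)).self_of_nhds,
    dirDeriv_sub_apply ((contDiffAt_dirDeriv hf _).differentiableAt (by norm_num))
      ((contDiffAt_dirDeriv hg _).differentiableAt (by norm_num))]
  simp only [Pi.sub_apply]
  ring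

theorem dirDeriv_const_mul (c : ℝ) (f : V → ℝ) (v : V) :
    dirDeriv v (fun y => c * f y) = fun y => c * dirDeriv v f y := by
  ext y
  change fderiv ℝ (c • f) y v = _
  rw [fderiv_const_smul_field]
  rfl

theorem expandedOp_const_mul (c : ℝ) (f : V → ℝ) :
    expandedOp e κ (fun y => c * f y) = fun y => c * expandedOp e κ f y := by
  ext y
  simp only [expandedOp, dirDeriv_const_mul, Finset.mul_sum]
  exact Finset.sum_congr rfl fun i _ => by ring

/-- Differentiation in a direction in which the coefficient `κ` is constant commutes with the
operator. -/
theorem dirDeriv_expandedOp (hκ : AnalyticAt ℝ κ x) (hf : AnalyticAt ℝ f x) (v : V)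
    (hv : ∀ᶠ y in 𝓝 x, dirDeriv v κ y = 0) :
    dirDeriv v (expandedOp e κ f) x = expandedOp e κ (dirDeriv v f) x := by
  have d1 := fun i => analyticAt_dirDeriv hf (e i)
  have d2 := fun i => analyticAt_dirDeriv (d1 i) (e i)
  have dκ := fun i => analyticAt_dirDeriv hκ (e i)
  unfold expandedOp
  refine (dirDeriv_sum_apply _ (fun i _ =>
    ((hκ.mul (d2 i)).add ((dκ i).mul (d1 i))).differentiableAt) v).trans ?_
  refine Finset.sum_congr rfl fun i _ => ?_
  have e1 := dirDeriv_add_apply (hκ.mul (d2 i)).differentiableAt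
    ((dκ i).mul (d1 i)).differentiableAt v
  refine e1.trans ?_
  rw [dirDeriv_mul_apply hκ.differentiableAt (d2 i).differentiableAt,
    dirDeriv_mul_apply (dκ i).differentiableAt (d1 i).differentiableAt, hv.self_of_nhds,
    (dirDeriv_comm hκ v (e i)).self_of_nhds, (dirDeriv_comm hf v (e i)).self_of_nhds,
    (dirDeriv_comm (d1 i) v (e i)).self_of_nhds,
    (dirDeriv_congr (dirDeriv_comm hf v (e i)) (e i)).self_of_nhds,
    dirDeriv_eq_zero_of_eventuallyEq_zero hv]
  ring

/-- Uniqueness in the analytic Cauchy problem with data on the hypersurface `ψ = 0`. -/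
theorem eventually_eq_zero_of_cauchy [CompleteSpace V] (hψ : AnalyticAt ℝ ψ x) (h0 : ψ x = 0)
    (hψe : ∃ i, dirDeriv (e i) ψ x ≠ 0) (hκ : AnalyticAt ℝ κ x) (hκ0 : κ x ≠ 0)
    (hg : AnalyticAt ℝ g x) (hpde : ∀ᶠ y in 𝓝 x, expandedOp e κ g y = 0)
    (hg0 : ∀ᶠ y in 𝓝 x, ψ y = 0 → g y = 0)
    (hg1 : ∀ v, ∀ᶠ y in 𝓝 x, ψ y = 0 → dirDeriv v g y = 0) :
    ∀ᶠ y in 𝓝 x, g y = 0 := by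
  obtain ⟨j, hj⟩ := hψe
  have hψd := analyticAt_dirDeriv hψ
  have hgd := analyticAt_dirDeriv hg
  -- The second derivatives of `g` are a priori of order `k` only. Tangential differentiation of
  -- first derivatives keeps order `k + 1`, and the equation supplies the remaining transversal
  -- derivative.
  have step : ∀ k, VanishOrder ψ x (k + 2) g → VanishOrder ψ x (k + 3) g := by
    intro k hk
    set w := e j with hw
    -- second derivatives are multiples of the pure second derivative along `w`
    have first : ∀ v z, VanishOrder ψ x (k + 1) (dirDeriv w ψ * dirDeriv v (dirDeriv z g) -
        dirDeriv v ψ * dirDeriv w (dirDeriv z g)) := fun v z => (hk.2.2 z).tangent hψ v w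
    have second : ∀ v z, VanishOrder ψ x (k + 1) (dirDeriv w ψ * dirDeriv w ψ *
        dirDeriv v (dirDeriv z g) - dirDeriv v ψ * dirDeriv z ψ * dirDeriv w (dirDeriv w g)) := by
      intro v z
      refine ((VanishOrder.mul_left (hψd w) (first v z)).add
        (VanishOrder.mul_left (hψd v) (first z w))).congr ?_
      filter_upwards [dirDeriv_comm hg w z] with y hy
      simp only [Pi.add_apply, Pi.mul_apply, Pi.sub_apply, hy]
      ring
    have lower : VanishOrder ψ x (k + 1) (∑ i, dirDeriv (e i) κ * dirDeriv (e i) g) :=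
      VanishOrder.sum _ fun i _ => VanishOrder.mul_left (analyticAt_dirDeriv hκ _) (hk.2.2 _)
    have laplace := VanishOrder.sum (Finset.univ : Finset ι) fun i _ => second (e i) (e i)
    have hN : AnalyticAt ℝ (∑ i, dirDeriv (e i) ψ * dirDeriv (e i) ψ) x :=
      Finset.analyticAt_sum _ fun i _ => (hψd _).mul (hψd _)
    have hN0 : (∑ i, dirDeriv (e i) ψ * dirDeriv (e i) ψ) x ≠ 0 := by
      simp only [Finset.sum_apply, Pi.mul_apply]
      refine ne_of_gt (Finset.sum_pos' (fun i _ => mul_self_nonneg _) ⟨j, by simp, ?_⟩)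
      exact mul_self_pos.2 hj
    -- Up to order `k + 1`, `(∂_w ψ)² ∑ ∂ᵢ²g` equals `N ∂_w²g` with `N = ∑ (∂ᵢψ)²`, while the
    -- equation makes `κ ∑ ∂ᵢ²g` a first-order expression. Since `κ N ≠ 0` at `x`, one may divide.
    have pure : VanishOrder ψ x (k + 1) (dirDeriv w (dirDeriv w g)) := by
      refine VanishOrder.of_mul_left hκ hκ0 (VanishOrder.of_mul_left hN hN0 ?_)
      refine ((VanishOrder.mul_left ((hψd w).mul (hψd w)) lower).add
        (VanishOrder.mul_left hκ laplace)).neg.congr ?_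
      filter_upwards [hpde] with y hy
      simp only [expandedOp, Finset.sum_add_distrib] at hy
      simp only [Pi.neg_apply, Pi.add_apply, Pi.mul_apply, Finset.sum_apply, Pi.sub_apply,
        Finset.sum_sub_distrib, ← Finset.mul_sum, ← Finset.sum_mul] at hy ⊢
      linear_combination (-(dirDeriv w ψ y * dirDeriv w ψ y)) * hy
    refine ⟨hg, hg0, fun z => ⟨hgd z, hg1 z, fun v => ?_⟩⟩
    refine VanishOrder.of_mul_left ((hψd w).mul (hψd w)) (mul_ne_zero hj hj) ?_
    refine ((second v z).add (VanishOrder.mul_left ((hψd v).mul (hψd z)) pure)).congr ?_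
    filter_upwards with y
    simp
  have all : ∀ k, VanishOrder ψ x (k + 2) g := by
    intro k
    induction k with
    | zero => exact ⟨hg, hg0, fun v => ⟨hgd v, hg1 v, fun z => analyticAt_dirDeriv (hgd v) z⟩⟩
    | succ k ih => exact step k ih
  exact VanishOrder.eventually_eq_zero h0 fun k => (all k).of_succ.of_succ

end ExpandedOp

/-! ### Connectedness after removing finitely many points; identity theorem -/

section Connected

variable {V : Type*} [NormedAddCommGroup V] [NormedSpace ℝ V]

/-- The punctured ball is the homeomorphic image of the punctured space. -/
theorem isPreconnected_ball_diff_center (h : 1 < Module.rank ℝ V) (c : V) {r : ℝ} (hr : 0 < r) :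
    IsPreconnected (Metric.ball c r \ {c}) := by
  have := (isConnected_compl_singleton_of_one_lt_rank h (0 : V)).isPreconnected.image
    (OpenPartialHomeomorph.univBall c r) (OpenPartialHomeomorph.continuous_univBall c r).continuousOn
  convert this using 1
  have hs : (OpenPartialHomeomorph.univBall c r).source = univ :=
    OpenPartialHomeomorph.univBall_source c r
  have ht := OpenPartialHomeomorph.univBall_target c hr
  have hinj : Function.Injective (OpenPartialHomeomorph.univBall c r) := fun a b hab =>
    (OpenPartialHomeomorph.univBall c r).injOn (by simp) (by simp) hab
  rw [Set.compl_eq_univ_sdiff, Set.image_sdiff hinj, ← hs,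
    (OpenPartialHomeomorph.univBall c r).image_source_eq_target, ht]
  simp

/-- A small punctured ball around `p` lies on one side of any separation of `U \ {p}`; filling `p`
in on that side would separate `U`. -/
theorem isPreconnected_diff_singleton (h : 1 < Module.rank ℝ V) {U : Set V} (hU : IsOpen U)
    (hc : IsPreconnected U) (p : V) : IsPreconnected (U \ {p}) := by
  by_cases hp : p ∈ U
  swap
  · rwa [sdiff_singleton_eq_self hp]
  obtain ⟨r, hr, hrU⟩ := Metric.isOpen_iff.1 hU p hp
  have hB := isPreconnected_ball_diff_center h p hr
  have hBU : Metric.ball p r \ {p} ⊆ U \ {p} := sdiff_subset_sdiff_left hrU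
  have aux : ∀ u v : Set V, IsOpen u → IsOpen v → U \ {p} ⊆ u ∪ v → (U \ {p} ∩ u).Nonempty →
      (U \ {p} ∩ v).Nonempty → Metric.ball p r \ {p} ⊆ u → (U \ {p} ∩ (u ∩ v)).Nonempty := by
    rintro u v hu hv huv ⟨a, ha, hau⟩ ⟨b, hb, hbv⟩ hBu
    obtain ⟨z, hzU, hz1, hz2⟩ := hc (u ∪ Metric.ball p r) (v \ {p}) (hu.union Metric.isOpen_ball)
      (hv.sdiff isClosed_singleton) (fun y hy => by
        by_cases hyp : y = p
        · exact Or.inl (Or.inr (by simpa [hyp] using hr))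
        · rcases huv ⟨hy, hyp⟩ with h' | h'
          · exact Or.inl (Or.inl h')
          · exact Or.inr ⟨h', hyp⟩) ⟨a, ha.1, Or.inl hau⟩ ⟨b, hb.1, hbv, hb.2⟩
    refine ⟨z, ⟨hzU, hz2.2⟩, ?_, hz2.1⟩
    rcases hz1 with h' | h'
    · exact h'
    · exact hBu ⟨h', hz2.2⟩
  intro u v hu hv huv hnu hnv
  by_cases he : (U \ {p} ∩ (u ∩ v)).Nonempty
  · exact he
  rcases isPreconnected_iff_subset_of_disjoint.1 hB u v hu hv (hBU.trans huv) (by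
    refine Set.eq_empty_of_forall_notMem fun z hz => he ⟨z, hBU hz.1, hz.2⟩) with h' | h'
  · exact aux u v hu hv huv hnu hnv h'
  · rw [inter_comm u v]
    exact aux v u hv hu (by rwa [union_comm]) hnv hnu h'

theorem isPreconnected_diff_finset (h : 1 < Module.rank ℝ V) {U : Set V} (hU : IsOpen U)
    (hc : IsPreconnected U) (S : Finset V) : IsPreconnected (U \ (S : Set V)) := by
  classical
  induction S using Finset.induction_on with
  | empty => simpa using hc
  | insert p S hp ih =>
    have : U \ ((insert p S : Finset V) : Set V) = (U \ (S : Set V)) \ {p} := by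
      ext y
      simp [not_or, and_assoc, and_comm]
    rw [this]
    exact isPreconnected_diff_singleton h (hU.sdiff S.finite_toSet.isClosed) ih p

/-- An analytic function that vanishes near points arbitrarily close to `x` vanishes near `x`. -/
theorem eventually_eq_zero_of_frequently {f : V → ℝ} {x : V} (hf : AnalyticAt ℝ f x)
    (h : ∃ᶠ y in 𝓝 x, ∀ᶠ z in 𝓝 y, f z = 0) : ∀ᶠ y in 𝓝 x, f y = 0 := by
  obtain ⟨r, hr, hB⟩ := Metric.eventually_nhds_iff_ball.1 hf.eventually_analyticAt
  obtain ⟨y, hy, hyr⟩ := (h.and_eventually (Metric.ball_mem_nhds x hr)).exists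
  have := AnalyticOnNhd.eqOn_zero_of_preconnected_of_eventuallyEq_zero (f := f)
    (fun z hz => hB z hz) Metric.isPreconnected_ball hyr hy
  exact Filter.eventually_of_mem (Metric.ball_mem_nhds x hr) this

end Connected

/-! ### Functions on space-time and their time slices -/

theorem eventually_slice {X Y : Type*} [TopologicalSpace X] [TopologicalSpace Y] {t : X} {x : Y}
    {p : X × Y → Prop} (h : ∀ᶠ z in 𝓝 (t, x), p z) : ∀ᶠ y in 𝓝 x, p (t, y) :=
  (Continuous.prodMk_right t).continuousAt.eventually h

section Slice

variable {V ι : Type*} [NormedAddCommGroup V] [NormedSpace ℝ V] [Fintype ι] {e : ι → V}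
  {κ : V → ℝ} {G : ℝ × V → ℝ} {t : ℝ} {x : V}

theorem dirDeriv_slice (h : DifferentiableAt ℝ G (t, x)) (v : V) :
    dirDeriv v (fun y => G (t, y)) x = dirDeriv ((0, v) : ℝ × V) G (t, x) := by
  have := h.hasFDerivAt.comp x (hasFDerivAt_prodMk_right t x)
  have := this.fderiv
  simp only [Function.comp_def] at this
  simp [dirDeriv, this]

theorem deriv_slice (h : DifferentiableAt ℝ G (t, x)) :
    deriv (fun s => G (s, x)) t = dirDeriv ((1, 0) : ℝ × V) G (t, x) := by
  have := h.hasFDerivAt.comp (f := fun s => (s, x)) t (hasFDerivAt_prodMk_left t x)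
  have := this.hasDerivAt.deriv
  simp only [Function.comp_def] at this
  simp [dirDeriv, this]

theorem dirDeriv_comp_snd (h : DifferentiableAt ℝ κ x) (τ : ℝ) (v : V) :
    dirDeriv ((τ, v) : ℝ × V) (fun p => κ p.2) (t, x) = dirDeriv v κ x := by
  have : HasFDerivAt (fun p : ℝ × V => κ p.2) _ (t, x) :=
    HasFDerivAt.comp (t, x) (g := κ) h.hasFDerivAt hasFDerivAt_snd
  simp [dirDeriv, this.fderiv]

theorem analyticAt_slice (h : AnalyticAt ℝ G (t, x)) : AnalyticAt ℝ (fun y => G (t, y)) x :=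
  AnalyticAt.comp (g := G) h (analyticAt_const.prod analyticAt_id)

theorem analyticAt_comp_snd (h : AnalyticAt ℝ κ x) :
    AnalyticAt ℝ (fun p : ℝ × V => κ p.2) (t, x) :=
  AnalyticAt.comp (g := κ) h analyticAt_snd

/-- Regards the spatial operator as one on space-time with directions `(0, e i)`, so that time is
just another direction and commutes with the others. -/
theorem expandedOp_slice (hG : ContDiffAt ℝ 2 G (t, x)) (hκ : DifferentiableAt ℝ κ x) :
    expandedOp e κ (fun y => G (t, y)) x =
      expandedOp (fun i => ((0, e i) : ℝ × V)) (fun p => κ p.2) G (t, x) := by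
  have h1 : ∀ i, dirDeriv (e i) (fun y => G (t, y)) =ᶠ[𝓝 x]
      fun y => dirDeriv ((0, e i) : ℝ × V) G (t, y) := fun i =>
    (eventually_slice (hG.eventually (by simp))).mono fun y hy =>
      dirDeriv_slice (hy.differentiableAt (by norm_num)) _
  refine Finset.sum_congr rfl fun i _ => ?_
  rw [(dirDeriv_congr (h1 i) (e i)).self_of_nhds, (h1 i).self_of_nhds,
    dirDeriv_slice ((contDiffAt_dirDeriv hG _).differentiableAt (by norm_num)),
    dirDeriv_comp_snd hκ]

/-- If an analytic function on space-time vanishes, for each time near `t`, near some point close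
to `x`, then it vanishes near `(t, x)`. -/
theorem eventually_eq_zero_of_slices (hG : AnalyticAt ℝ G (t, x))
    (h : ∀ r > 0, ∀ᶠ s in 𝓝 t, ∃ y ∈ Metric.ball x r, ∀ᶠ z in 𝓝 y, G (s, z) = 0) :
    ∀ᶠ p in 𝓝 (t, x), G p = 0 := by
  -- This radius of joint analyticity serves all times near `t`, so the identity theorem applies on
  -- the same ball in each slice.
  obtain ⟨r, hr, hB⟩ := Metric.eventually_nhds_iff_ball.1 hG.eventually_analyticAt
  rw [nhds_prod_eq]
  filter_upwards [((h r hr).and (Metric.ball_mem_nhds t hr)).prod_mk (Metric.ball_mem_nhds x hr)]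
    with p hp
  obtain ⟨⟨⟨y, hy, hz⟩, hs⟩, hx⟩ := hp
  have han : AnalyticOnNhd ℝ (fun y => G (p.1, y)) (Metric.ball x r) := by
    intro z hz'
    refine analyticAt_slice (hB _ ?_)
    rw [← ball_prod_same]
    exact ⟨hs, hz'⟩
  exact han.eqOn_zero_of_preconnected_of_eventuallyEq_zero Metric.isPreconnected_ball hy hz hx

end Slice

/-! ### Gradient and divergence form in coordinates -/

section Euclidean

variable {n : ℕ}

/-- The standard basis vectors of `ℝⁿ`. -/
noncomputable abbrev basisVec (n : ℕ) (i : Fin n) : E n := EuclideanSpace.single i 1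

theorem inner_gradient (f : E n → ℝ) (x v : E n) : inner ℝ (gradient f x) v = dirDeriv v f x := by
  simp [gradient, dirDeriv]

theorem gradient_apply (f : E n → ℝ) (x : E n) (i : Fin n) :
    gradient f x i = dirDeriv (basisVec n i) f x := by
  rw [← inner_gradient, EuclideanSpace.inner_single_right]
  simp

theorem exists_dirDeriv_ne_zero {f : E n → ℝ} {x : E n} (h : gradient f x ≠ 0) :
    ∃ i, dirDeriv (basisVec n i) f x ≠ 0 := by
  by_contra! hc
  refine h ?_
  ext i
  simp [gradient_apply, hc i]

/-- Requires only `C²`, since it is also applied to `q`. -/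
theorem ellipticOp_eq_expandedOp {lam rho f : E n → ℝ} {x : E n} (hf : ContDiffAt ℝ 2 f x)
    (hl : DifferentiableAt ℝ lam x) (hr : DifferentiableAt ℝ rho x) :
    ellipticOp lam rho f x = expandedOp (basisVec n) (lam * rho) f x := by
  have hd : ∀ i, DifferentiableAt ℝ (dirDeriv (basisVec n i) f) x := fun i =>
    (contDiffAt_dirDeriv hf _).differentiableAt (by norm_num)
  have hF : DifferentiableAt ℝ (fun y => (lam y * rho y) • gradient f y) x := by
    rw [differentiableAt_euclidean]
    intro i
    simp only [PiLp.smul_apply, gradient_apply, smul_eq_mul]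
    exact (hl.mul hr).mul (hd i)
  unfold ellipticOp divergence expandedOp
  refine Finset.sum_congr rfl fun i _ => ?_
  have h1 := ((EuclideanSpace.proj (𝕜 := ℝ) i).hasFDerivAt.comp x hF.hasFDerivAt).fderiv
  have h2 : (EuclideanSpace.proj (𝕜 := ℝ) i) ∘ (fun y => (lam y * rho y) • gradient f y) =
      (lam * rho) * dirDeriv (basisVec n i) f := by
    ext y
    simp [gradient_apply]
  rw [h2] at h1
  have h3 := congrArg (fun L : E n →L[ℝ] ℝ => L (basisVec n i)) h1
  refine Eq.trans h3.symm ?_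
  exact dirDeriv_mul_apply (hl.mul hr) (hd i) _

theorem eventually_ellipticOp_eq {lam rho f : E n → ℝ} {x : E n} (hf : AnalyticAt ℝ f x)
    (hl : AnalyticAt ℝ lam x) (hr : AnalyticAt ℝ rho x) :
    ellipticOp lam rho f =ᶠ[𝓝 x] expandedOp (basisVec n) (lam * rho) f := by
  filter_upwards [hf.eventually_analyticAt, hl.eventually_analyticAt, hr.eventually_analyticAt]
    with y h1 h2 h3
  exact ellipticOp_eq_expandedOp h1.contDiffAt h2.differentiableAt h3.differentiableAt

theorem analyticAt_ellipticOp {lam rho f : E n → ℝ} {x : E n} (hf : AnalyticAt ℝ f x)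
    (hl : AnalyticAt ℝ lam x) (hr : AnalyticAt ℝ rho x) :
    AnalyticAt ℝ (ellipticOp lam rho f) x :=
  (analyticAt_expandedOp (hl.mul hr) hf).congr (eventually_ellipticOp_eq hf hl hr).symm

end Euclidean

/-! ### Local geometry of the moving boundary -/

section Boundary

variable {n : ℕ} {I : Set ℝ} {Om : ℝ → Set (E n)} {φ : ℝ × E n → ℝ} {t : ℝ} {x : E n}

namespace IsLocalDefiningFunction

theorem eventually_dirDeriv_ne_zero (h : IsLocalDefiningFunction Om φ t x) :
    ∃ i, ∀ᶠ p in 𝓝 (t, x), dirDeriv ((0, basisVec n i) : ℝ × E n) φ p ≠ 0 := by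
  obtain ⟨i, hi⟩ := exists_dirDeriv_ne_zero h.2.1
  rw [dirDeriv_slice h.1.differentiableAt] at hi
  exact ⟨i, (analyticAt_dirDeriv h.1 _).continuousAt.eventually_ne hi⟩

/-- As `∇ₓφ ≠ 0`, a zero of `φ (s, ·)` is not a local minimum, so points of the domain accumulate
there; the zero itself is not in the domain. -/
theorem eventually_mem_frontier (h : IsLocalDefiningFunction Om φ t x) :
    ∀ᶠ p in 𝓝 (t, x), φ p = 0 → p.2 ∈ frontier (Om p.1) := by
  obtain ⟨i, hi⟩ := h.eventually_dirDeriv_ne_zero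
  filter_upwards [hi, h.2.2.eventually_nhds, h.1.eventually_analyticAt] with p hp hO ha h0
  obtain ⟨s, y⟩ := p
  have hO' := eventually_slice hO
  refine ⟨?_, ?_⟩
  · rw [mem_closure_iff_frequently]
    have hneg : ∃ᶠ z in 𝓝 y, φ (s, z) < 0 := by
      intro hc
      have hmin : IsLocalMin (fun z => φ (s, z)) y := by
        filter_upwards [hc] with z hz
        rw [h0]
        exact not_lt.1 hz
      refine hp ?_
      rw [← dirDeriv_slice ha.differentiableAt, dirDeriv, hmin.fderiv_eq_zero]
      rfl
    exact (hneg.and_eventually hO').mono fun z hz => hz.2.2 hz.1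
  · intro hy
    have := (hO.self_of_nhds.1 (interior_subset hy))
    exact this.ne h0

theorem eq_zero_of_mem_frontier (h : IsLocalDefiningFunction Om φ t x) (ho : IsOpen (Om t))
    (hx : x ∈ frontier (Om t)) : φ (t, x) = 0 := by
  have hc : ContinuousAt (fun y => φ (t, y)) x := (analyticAt_slice h.1).continuousAt
  refine le_antisymm ?_ ?_
  · have hf := (mem_closure_iff_frequently.1 (frontier_subset_closure hx)).and_eventually
      (eventually_slice h.2.2)
    by_contra! hpos
    obtain ⟨y, hy, hy'⟩ := (hf.and_eventually (hc.eventually_const_lt hpos)).exists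
    exact absurd (hy.2.1 hy.1) (not_lt.2 hy'.le)
  · by_contra! hneg
    rw [ho.frontier_eq] at hx
    exact hx.2 (h.2.2.self_of_nhds.2 hneg)

/-- `φ (t, ·)` takes both signs near `x`. The signs at two fixed points persist for nearby times,
and the intermediate value theorem on a ball gives a zero. -/
theorem eventually_exists_eq_zero (h : IsLocalDefiningFunction Om φ t x) (h0 : φ (t, x) = 0)
    {r : ℝ} (hr : 0 < r) : ∀ᶠ s in 𝓝 t, ∃ y ∈ Metric.ball x r, φ (s, y) = 0 := by
  obtain ⟨ε, hε, hB⟩ := Metric.eventually_nhds_iff_ball.1 h.1.eventually_analyticAt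
  set δ := min ε r
  have hδ : 0 < δ := lt_min hε hr
  have hcont : ∀ s ∈ Metric.ball t ε, ∀ y ∈ Metric.ball x δ, ContinuousAt φ (s, y) := by
    intro s hs y hy
    refine (hB _ ?_).continuousAt
    rw [← ball_prod_same]
    exact ⟨hs, Metric.ball_subset_ball (min_le_left _ _) hy⟩
  obtain ⟨i, hi⟩ := exists_dirDeriv_ne_zero h.2.1
  have hneg : ∃ y ∈ Metric.ball x δ, φ (t, y) < 0 := by
    by_contra! hc
    refine hi ?_
    have hmin : IsLocalMin (fun z => φ (t, z)) x := by
      filter_upwards [Metric.ball_mem_nhds x hδ] with z hz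
      rw [h0]
      exact hc z hz
    rw [dirDeriv, hmin.fderiv_eq_zero]
    rfl
  have hpos : ∃ y ∈ Metric.ball x δ, 0 < φ (t, y) := by
    by_contra! hc
    refine hi ?_
    have hmax : IsLocalMax (fun z => φ (t, z)) x := by
      filter_upwards [Metric.ball_mem_nhds x hδ] with z hz
      rw [h0]
      exact hc z hz
    rw [dirDeriv, hmax.fderiv_eq_zero]
    rfl
  obtain ⟨a, ha, hφa⟩ := hneg
  obtain ⟨b, hb, hφb⟩ := hpos
  have htime : ∀ y ∈ Metric.ball x δ, ContinuousAt (fun s => φ (s, y)) t := fun y hy =>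
    (hcont t (Metric.mem_ball_self hε) y hy).comp (f := fun s => (s, y)) (by fun_prop)
  filter_upwards [(htime a ha).eventually_lt_const hφa, (htime b hb).eventually_const_lt hφb,
    Metric.ball_mem_nhds t hε] with s hsa hsb hs
  obtain ⟨y, hy, hy0⟩ := Metric.isPreconnected_ball.intermediate_value ha hb
    (f := fun y => φ (s, y)) (fun y hy =>
      ((hcont s hs y hy).comp (f := fun y => (s, y)) (by fun_prop)).continuousWithinAt)
    ⟨hsa.le, hsb.le⟩
  exact ⟨y, Metric.ball_subset_ball (min_le_right _ _) hy, hy0⟩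

end IsLocalDefiningFunction

/-- The boundary of a time slice lies in the boundary of the space-time region. -/
theorem IsAnalyticMovingDomain.exists_localDefiningFunction (h : IsAnalyticMovingDomain I Om)
    (ht : t ∈ I) (hx : x ∈ frontier (Om t)) : ∃ φ, IsLocalDefiningFunction Om φ t x := by
  refine h.analytic_boundary t ht x ?_
  rw [(h.isOpen t ht).frontier_eq] at hx
  constructor
  · have hc : Continuous fun y : E n => (t, y) := Continuous.prodMk_right t
    exact map_mem_closure hc hx.1 fun y hy => ⟨ht, hy⟩
  · exact fun hi => hx.2 (interior_subset hi).2

end Boundary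

/-! ### Equation and Cauchy data of the time derivative -/

section TimeDerivative

variable {n : ℕ} {I : Set ℝ} {Om : ℝ → Set (E n)} {lam rho q : E n → ℝ} {u : ℝ → E n → ℝ}
  {φ : ℝ × E n → ℝ} {t : ℝ} {x : E n}

theorem eventually_deriv_slice (hu : AnalyticAt ℝ (fun p : ℝ × E n => u p.1 p.2) (t, x)) :
    (fun y => deriv (fun s => u s y) t) =ᶠ[𝓝 x]
      fun y => dirDeriv ((1, 0) : ℝ × E n) (fun p => u p.1 p.2) (t, y) :=
  (eventually_slice hu.eventually_analyticAt).mono fun _ hy => deriv_slice hy.differentiableAt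

theorem analyticAt_deriv_slice (hu : AnalyticAt ℝ (fun p : ℝ × E n => u p.1 p.2) (t, x)) :
    AnalyticAt ℝ (fun y => deriv (fun s => u s y) t) x :=
  (analyticAt_slice (analyticAt_dirDeriv hu _)).congr (eventually_deriv_slice hu).symm

/-- The time derivative of solutions of an elliptic equation near a moving surface is again a
solution. -/
theorem eventually_expandedOp_deriv_eq_zero (hI : IsOpen I) (ht : t ∈ I)
    (hφ : IsLocalDefiningFunction Om φ t x) (h0 : φ (t, x) = 0)
    (hl : AnalyticAt ℝ lam x) (hr : AnalyticAt ℝ rho x)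
    (hu : AnalyticAt ℝ (fun p : ℝ × E n => u p.1 p.2) (t, x))
    (hpde : ∀ s ∈ I, ∀ᶠ y in 𝓝ˢ (frontier (Om s)), ellipticOp lam rho (u s) y = 0) :
    ∀ᶠ y in 𝓝 x, expandedOp (basisVec n) (lam * rho)
      (fun y => deriv (fun s => u s y) t) y = 0 := by
  set U : ℝ × E n → ℝ := fun p => u p.1 p.2 with hU
  set e' : Fin n → ℝ × E n := fun i => (0, basisVec n i) with he'
  set κ : ℝ × E n → ℝ := fun p => (lam * rho) p.2 with hκ
  have hlr : AnalyticAt ℝ (lam * rho) x := hl.mul hr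
  have hκa : AnalyticAt ℝ κ (t, x) := analyticAt_comp_snd hlr
  have snd_tendsto : Tendsto (fun p : ℝ × E n => p.2) (𝓝 (t, x)) (𝓝 x) := continuous_snd.tendsto _
  have hG : ∀ᶠ p in 𝓝 (t, x), expandedOp e' κ U p = ellipticOp lam rho (u p.1) p.2 := by
    filter_upwards [hu.eventually_analyticAt, snd_tendsto.eventually hl.eventually_analyticAt,
      snd_tendsto.eventually hr.eventually_analyticAt] with p h1 h2 h3
    obtain ⟨s, y⟩ := p
    rw [ellipticOp_eq_expandedOp (analyticAt_slice h1).contDiffAt h2.differentiableAt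
      h3.differentiableAt]
    exact (expandedOp_slice (G := U) h1.contDiffAt (h2.mul h3).differentiableAt).symm
  -- The equation for `u s` holds near the boundary at time `s`, on a neighborhood whose size may
  -- depend on `s`. Analyticity makes it hold on a full space-time neighborhood, so that it can be
  -- differentiated in time.
  have hzero : ∀ᶠ p in 𝓝 (t, x), expandedOp e' κ U p = 0 := by
    refine eventually_eq_zero_of_slices (analyticAt_expandedOp hκa hu) fun r hr => ?_
    obtain ⟨ε, hε, hB⟩ := Metric.eventually_nhds_iff_ball.1
      (hG.eventually_nhds.and hφ.eventually_mem_frontier)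
    filter_upwards [hφ.eventually_exists_eq_zero h0 (lt_min hr hε), hI.mem_nhds ht,
      Metric.ball_mem_nhds t hε] with s hs hsI hst
    obtain ⟨y, hy, hy0⟩ := hs
    obtain ⟨h1, h2⟩ := hB (s, y) (by
      rw [← ball_prod_same]
      exact ⟨hst, Metric.ball_subset_ball (min_le_right _ _) hy⟩)
    refine ⟨y, Metric.ball_subset_ball (min_le_left _ _) hy, ?_⟩
    filter_upwards [eventually_slice h1, eventually_nhdsSet_iff_forall.1 (hpde s hsI) y (h2 hy0)]
      with z hz hz'
    rw [hz, hz']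
  have hκt : ∀ᶠ p in 𝓝 (t, x), dirDeriv ((1, 0) : ℝ × E n) κ p = 0 := by
    filter_upwards [snd_tendsto.eventually hlr.eventually_analyticAt] with p hp
    refine (dirDeriv_comp_snd (t := p.1) hp.differentiableAt 1 0).trans ?_
    simp [dirDeriv]
  have htime : ∀ᶠ p in 𝓝 (t, x), expandedOp e' κ (dirDeriv ((1, 0) : ℝ × E n) U) p = 0 := by
    filter_upwards [hzero.eventually_nhds, hκt.eventually_nhds, hκa.eventually_analyticAt,
      hu.eventually_analyticAt] with p h1 h2 h3 h4
    rw [← dirDeriv_expandedOp h3 h4 _ h2]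
    exact dirDeriv_eq_zero_of_eventuallyEq_zero h1 _
  filter_upwards [eventually_slice htime,
    expandedOp_congr (e := basisVec n) (κ := lam * rho) (eventually_deriv_slice hu),
    hlr.eventually_analyticAt, eventually_slice hu.eventually_analyticAt] with y h1 h2 h3 h4
  rw [h2]
  exact (expandedOp_slice (analyticAt_dirDeriv h4 _).contDiffAt h3.differentiableAt).trans h1

/-- The Cauchy data on the moving boundary of the time derivative of the generalized Schwarz
potential, in terms of a local defining function. -/
theorem deriv_schwarzPotential (hI : IsOpen I) (ht : t ∈ I)
    (hφ : IsLocalDefiningFunction Om φ t x) (h0 : φ (t, x) = 0)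
    (hl : AnalyticAt ℝ lam x) (hr : AnalyticAt ℝ rho x) (hl0 : lam x ≠ 0) (hr0 : rho x ≠ 0)
    (hq : ContDiffAt ℝ 2 q x) (hq_pde : ellipticOp lam rho q x = n * rho x)
    (hua : AnalyticAt ℝ (fun p : ℝ × E n => u p.1 p.2) (t, x))
    (hu_pde : ellipticOp lam rho (u t) x = 0)
    (hval : ∀ s ∈ I, ∀ y ∈ frontier (Om s), u s y = q y)
    (hgrad : ∀ s ∈ I, ∀ y ∈ frontier (Om s), gradient (u s) y = gradient q y) :
    deriv (fun s => u s x) t = 0 ∧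
      gradient (fun y => deriv (fun s => u s y) t) x =
        -(n * deriv (fun s => φ (s, x)) t / (lam x * ‖gradient (fun y => φ (t, y)) x‖ ^ 2)) •
          gradient (fun y => φ (t, y)) x := by
  set U : ℝ × E n → ℝ := fun p => u p.1 p.2 with hU
  set Qs : ℝ × E n → ℝ := fun p => q p.2 with hQs
  set W : ℝ × E n → ℝ := U - Qs with hW
  set e' : Fin n → ℝ × E n := fun i => (0, basisVec n i) with he'
  set τ : ℝ × E n := (1, 0) with hτ
  have snd_tendsto : Tendsto (fun p : ℝ × E n => p.2) (𝓝 (t, x)) (𝓝 x) := continuous_snd.tendsto _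
  have hU2 : ContDiffAt ℝ 2 U (t, x) := hua.contDiffAt
  have hQ2 : ContDiffAt ℝ 2 Qs (t, x) :=
    ContDiffAt.comp (g := q) (t, x) hq contDiffAt_snd
  have hW2 : ContDiffAt ℝ 2 W (t, x) := hU2.sub hQ2
  have hφ1 : ContDiffAt ℝ 1 φ (t, x) := hφ.1.contDiffAt
  have hqd : ∀ᶠ p in 𝓝 (t, x), DifferentiableAt ℝ q p.2 :=
    snd_tendsto.eventually ((hq.eventually (by simp)).mono fun y hy =>
      hy.differentiableAt (by norm_num))
  have hUd : ∀ᶠ p in 𝓝 (t, x), DifferentiableAt ℝ U p :=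
    hua.eventually_analyticAt.mono fun y hy => hy.differentiableAt
  have hWdir : ∀ᶠ p in 𝓝 (t, x), ∀ a v, dirDeriv ((a, v) : ℝ × E n) W p =
      dirDeriv ((a, v) : ℝ × E n) U p - dirDeriv v q p.2 := by
    filter_upwards [hqd, hUd] with p h1 h2 a v
    have h3 : DifferentiableAt ℝ Qs p := DifferentiableAt.comp (g := q) p h1 differentiableAt_snd
    rw [hW, dirDeriv_sub_apply h2 h3]
    exact congrArg _ (dirDeriv_comp_snd (t := p.1) h1 a v)
  have hon : ∀ᶠ p in 𝓝 (t, x), φ p = 0 → p.1 ∈ I ∧ p.2 ∈ frontier (Om p.1) := by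
    filter_upwards [hφ.eventually_mem_frontier,
      (continuous_fst.tendsto (t, x)).eventually (hI.mem_nhds ht)] with p h1 h2 h3
    exact ⟨h2, h1 h3⟩
  have hW0 : ∀ᶠ p in 𝓝 (t, x), φ p = 0 → W p = 0 := by
    filter_upwards [hon] with p hp hp0
    simp [hW, hU, hQs, hval _ (hp hp0).1 _ (hp hp0).2]
  have hWi0 : ∀ i, ∀ᶠ p in 𝓝 (t, x), φ p = 0 → dirDeriv (e' i) W p = 0 := by
    intro i
    filter_upwards [hon, hWdir, hUd] with p hp h1 h2 hp0
    obtain ⟨s, y⟩ := p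
    rw [h1, ← dirDeriv_slice h2, ← inner_gradient, ← inner_gradient]
    simp only [hU, hgrad _ (hp hp0).1 _ (hp hp0).2, sub_self]
  have hWτ : dirDeriv τ W =ᶠ[𝓝 (t, x)] dirDeriv τ U := by
    filter_upwards [hWdir] with p hp
    rw [hτ, hp]
    simp [dirDeriv]
  obtain ⟨j, hj⟩ := exists_dirDeriv_ne_zero hφ.2.1
  have hφs : ∀ i, dirDeriv (basisVec n i) (fun y => φ (t, y)) x = dirDeriv (e' i) φ (t, x) :=
    fun i => dirDeriv_slice hφ.1.differentiableAt _
  rw [hφs] at hj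
  have hWx : ∀ i, dirDeriv (e' i) W (t, x) = 0 := fun i => (hWi0 i).self_of_nhds h0
  refine ⟨?_, ?_⟩
  · have := fderiv_parallel (hW2.of_le (by norm_num)) hφ1 h0 hW0 τ (e' j)
    -- Parallel differentials give `∂ₜW ∂ⱼφ = ∂ⱼW ∂ₜφ = 0` with `∂ⱼφ ≠ 0`.
    rw [hWx, zero_mul, mul_eq_zero, or_iff_left hj, hWτ.self_of_nhds] at this
    rw [← this]
    exact deriv_slice hua.differentiableAt
  set w : Fin n → Fin n → ℝ := fun i k => dirDeriv (e' k) (dirDeriv (e' i) W) (t, x) with hw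
  have hsymm : ∀ i k, w i k = w k i := fun i k => dirDeriv_comm_apply hW2 _ _
  have hpar := fun i => fderiv_parallel (contDiffAt_dirDeriv hW2 (e' i)) hφ1 h0 (hWi0 i)
  set N : ℝ := ∑ k, dirDeriv (e' k) φ (t, x) ^ 2 with hN
  have hN0 : 0 < N := Finset.sum_pos' (fun i _ => sq_nonneg _) ⟨j, by simp, by positivity⟩
  have hnorm : ‖gradient (fun y => φ (t, y)) x‖ ^ 2 = N := by
    rw [EuclideanSpace.real_norm_sq_eq]
    simp only [gradient_apply, hφs, hN]
  -- The first-order terms drop out because `∇W = 0` at the point.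
  have htrace : lam x * ∑ k, w k k = -n := by
    have h1 : expandedOp (basisVec n) (lam * rho) (u t - q) x = -(n * rho x) := by
      rw [expandedOp_sub_apply (analyticAt_slice hua).contDiffAt hq,
        ← ellipticOp_eq_expandedOp (analyticAt_slice hua).contDiffAt hl.differentiableAt
          hr.differentiableAt,
        ← ellipticOp_eq_expandedOp hq hl.differentiableAt hr.differentiableAt, hq_pde, hu_pde]
      ring
    have h2 := expandedOp_slice (e := basisVec n) hW2 (hl.mul hr).differentiableAt
    rw [show (fun y => W (t, y)) = u t - q from rfl, h1] at h2
    have h3 : expandedOp e' (fun p => (lam * rho) p.2) W (t, x) =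
        lam x * rho x * ∑ k, w k k := by
      simp only [expandedOp, hWx, mul_zero, add_zero, ← Finset.mul_sum, hw]
      rfl
    refine mul_right_cancel₀ hr0 ?_
    rw [h3] at h2
    linear_combination -h2
  ext i
  have hi : dirDeriv (basisVec n i) (fun y => deriv (fun s => u s y) t) x =
      dirDeriv τ (dirDeriv (e' i) W) (t, x) := by
    rw [(dirDeriv_congr (eventually_deriv_slice hua) _).self_of_nhds,
      dirDeriv_slice (analyticAt_dirDeriv hua _).differentiableAt,
      dirDeriv_comm_apply hW2, (dirDeriv_congr hWτ _).self_of_nhds]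
  -- For each `k`, parallelism gives `∂ₜ∂ᵢW ∂ₖφ = ∂ₖ∂ᵢW ∂ₜφ` and `∂ᵢ∂ₖW ∂ₖφ = ∂ₖ∂ₖW ∂ᵢφ`. Multiply
  -- the first by `∂ₖφ`, substitute the second, and sum over `k`.
  have hmain : dirDeriv τ (dirDeriv (e' i) W) (t, x) * N =
      dirDeriv τ φ (t, x) * dirDeriv (e' i) φ (t, x) * ∑ k, w k k := by
    rw [hN, Finset.mul_sum, Finset.mul_sum]
    refine Finset.sum_congr rfl fun k _ => ?_
    have h1 := hpar i τ (e' k)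
    have h2 := hpar k (e' i) (e' k)
    have h3 := hsymm i k
    simp only [hw] at h3 ⊢
    linear_combination dirDeriv (e' k) φ (t, x) * h1 +
      dirDeriv τ φ (t, x) * dirDeriv (e' k) φ (t, x) * h3 + dirDeriv τ φ (t, x) * h2
  rw [PiLp.smul_apply, gradient_apply, gradient_apply, hnorm, hi, hφs,
    deriv_slice hφ.1.differentiableAt, smul_eq_mul]
  field_simp
  linear_combination lam x * hmain + dirDeriv τ φ (t, x) * dirDeriv (e' i) φ (t, x) * htrace

end TimeDerivative

/-- Near a boundary point of the open set `D` there are points of `D` outside the finite set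
`S ⊆ D`. -/
theorem frequently_mem_diff_of_mem_frontier {X : Type*} [TopologicalSpace X] [T1Space X]
    {D : Set X} (hD : IsOpen D) {S : Finset X} (hS : (S : Set X) ⊆ D) {x : X}
    (hx : x ∈ frontier D) : ∃ᶠ y in 𝓝 x, y ∈ D \ (S : Set X) := by
  rw [hD.frontier_eq] at hx
  have h := S.finite_toSet.isClosed.isOpen_compl.mem_nhds fun hxS => hx.2 (hS hxS)
  exact ((mem_closure_iff_frequently.1 hx.1).and_eventually h).mono fun y hy => hy

end EllipticGrowth

/-! ### The equivalence -/

theorem theorem3 {n : ℕ} (hn : 2 ≤ n)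
    (I : Set ℝ) (hI : IsOpen I)
    -- the moving domain, with analytic boundary and analytic time-dependence
    (Om : ℝ → Set (EllipticGrowth.E n))
    (hOm : EllipticGrowth.IsAnalyticMovingDomain I Om)
    -- the medium: filtration and porosity
    (lam rho : EllipticGrowth.E n → ℝ)
    (hlam : ∀ t ∈ I, AnalyticOnNhd ℝ lam (closure (Om t)))
    (hrho : ∀ t ∈ I, AnalyticOnNhd ℝ rho (closure (Om t)))
    (hlam_pos : ∀ t ∈ I, ∀ x ∈ closure (Om t), 0 < lam x)
    (hrho_pos : ∀ t ∈ I, ∀ x ∈ closure (Om t), 0 < rho x)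
    -- a solution of the Poisson equation near the boundaries
    (q : EllipticGrowth.E n → ℝ)
    (hq : ∀ t ∈ I, ∀ x ∈ frontier (Om t), ContDiffAt ℝ 2 q x)
    (hq_pde : ∀ t ∈ I, ∀ᶠ x in 𝓝ˢ (frontier (Om t)),
      EllipticGrowth.ellipticOp lam rho q x = n * rho x)
    -- the generalized Schwarz potential, jointly analytic near the moving boundary
    (u : ℝ → EllipticGrowth.E n → ℝ)
    (hu_analytic : ∀ t ∈ I, ∀ x ∈ frontier (Om t),
      AnalyticAt ℝ (fun p : ℝ × EllipticGrowth.E n => u p.1 p.2) (t, x))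
    (hu : ∀ t ∈ I,
      EllipticGrowth.IsGeneralizedSchwarzPotential lam rho q (frontier (Om t)) (u t))
    -- a function whose only singularities in the domains are at the sinks
    (S : Finset (EllipticGrowth.E n)) (Q : ℝ → EllipticGrowth.E n → ℝ)
    (hQ : ∀ t ∈ I, ∀ s ∈ S, Q t s ≠ 0)
    (P : ℝ → EllipticGrowth.E n → ℝ)
    (hP : ∀ t ∈ I, EllipticGrowth.HasSinks lam rho (Om t) S (Q t) (P t)) :
    EllipticGrowth.IsEllipticGrowth I lam rho S Q Om P ↔
      ∀ t ∈ I, ∀ᶠ x in 𝓝ˢ (frontier (Om t)),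
        deriv (fun s => u s x) t = -(n : ℝ) * P t x := by
  have hn0 : (n : ℝ) ≠ 0 := by
    have : 0 < n := by omega
    exact_mod_cast this.ne'
  have hl : ∀ t ∈ I, ∀ x ∈ frontier (Om t), AnalyticAt ℝ lam x := fun t ht x hx =>
    hlam t ht x (frontier_subset_closure hx)
  have hr : ∀ t ∈ I, ∀ x ∈ frontier (Om t), AnalyticAt ℝ rho x := fun t ht x hx =>
    hrho t ht x (frontier_subset_closure hx)
  have hl0 : ∀ t ∈ I, ∀ x ∈ frontier (Om t), lam x ≠ 0 := fun t ht x hx =>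
    (hlam_pos t ht x (frontier_subset_closure hx)).ne'
  set v : ℝ → EllipticGrowth.E n → ℝ := fun t y => deriv (fun s => u s y) t with hv
  have hva : ∀ t ∈ I, ∀ x ∈ frontier (Om t), AnalyticAt ℝ (v t) x := fun t ht x hx =>
    EllipticGrowth.analyticAt_deriv_slice (hu_analytic t ht x hx)
  have hvpde : ∀ t ∈ I, ∀ x ∈ frontier (Om t),
      ∀ᶠ y in 𝓝 x, EllipticGrowth.expandedOp (EllipticGrowth.basisVec n) (lam * rho) (v t) y = 0 := by
    intro t ht x hx
    obtain ⟨φ, hφ⟩ := hOm.exists_localDefiningFunction ht hx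
    exact EllipticGrowth.eventually_expandedOp_deriv_eq_zero hI ht hφ
      (hφ.eq_zero_of_mem_frontier (hOm.isOpen t ht) hx) (hl t ht x hx) (hr t ht x hx)
      (hu_analytic t ht x hx) fun s hs => (hu s hs).pde
  -- the Cauchy data of the time derivative
  have hdata : ∀ t ∈ I, ∀ x ∈ frontier (Om t), ∀ φ, EllipticGrowth.IsLocalDefiningFunction Om φ t x →
      v t x = 0 ∧ gradient (v t) x =
        -(n * deriv (fun s => φ (s, x)) t / (lam x * ‖gradient (fun y => φ (t, y)) x‖ ^ 2)) •
          gradient (fun y => φ (t, y)) x := by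
    intro t ht x hx φ hφ
    exact EllipticGrowth.deriv_schwarzPotential hI ht hφ (hφ.eq_zero_of_mem_frontier (hOm.isOpen t ht) hx)
      (hl t ht x hx) (hr t ht x hx) (hl0 t ht x hx)
      (hrho_pos t ht x (frontier_subset_closure hx)).ne' (hq t ht x hx)
      (eventually_nhdsSet_iff_forall.1 (hq_pde t ht) x hx).self_of_nhds (hu_analytic t ht x hx)
      (eventually_nhdsSet_iff_forall.1 (hu t ht).pde x hx).self_of_nhds
      (fun s hs => (hu s hs).value) (fun s hs => (hu s hs).grad)
  constructor
  · intro hEG t ht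
    rw [eventually_nhdsSet_iff_forall]
    have hgradP : ∀ x ∈ frontier (Om t),
        gradient (v t) x = (-(n : ℝ)) • gradient (P t) x := by
      intro x hx
      -- Darcy's law comes with its own defining function, which is admissible because `hdata` holds
      -- for every one.
      obtain ⟨φ, hφ, hD⟩ := hEG.darcy t ht x hx
      have hl0' := hl0 t ht x hx
      have hP' : gradient (P t) x = (deriv (fun s => φ (s, x)) t /
          (lam x * ‖gradient (fun y => φ (t, y)) x‖ ^ 2)) •
            gradient (fun y => φ (t, y)) x := by
        rw [neg_smul, neg_inj] at hD
        rw [← inv_smul_smul₀ hl0' (gradient (P t) x), hD, smul_smul]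
        congr 1
        field_simp
      rw [(hdata t ht x hx φ hφ).2, hP', smul_smul]
      congr 1
      ring
    intro x hx
    obtain ⟨φ, hφ⟩ := hOm.exists_localDefiningFunction ht hx
    have hPa := hEG.regular t ht x hx
    -- The equation for `P` is assumed only inside the domain; analyticity of `P` at the boundary
    -- carries it across.
    have hPpde : ∀ᶠ y in 𝓝 x, EllipticGrowth.expandedOp (EllipticGrowth.basisVec n) (lam * rho) (P t) y = 0 := by
      have hop := (hOm.isOpen t ht).sdiff S.finite_toSet.isClosed
      have := EllipticGrowth.eventually_eq_zero_of_frequently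
        (EllipticGrowth.analyticAt_ellipticOp hPa (hl t ht x hx) (hr t ht x hx))
        ((EllipticGrowth.frequently_mem_diff_of_mem_frontier (hOm.isOpen t ht) (hP t ht).subset hx).mono
          fun y hy => eventually_of_mem (hop.mem_nhds hy) (hEG.pde t ht))
      filter_upwards [this, EllipticGrowth.eventually_ellipticOp_eq hPa (hl t ht x hx) (hr t ht x hx)]
        with y h1 h2
      rw [← h2, h1]
    have hpa : AnalyticAt ℝ (fun y => -(n : ℝ) * P t y) x := analyticAt_const.mul hPa
    have hzero : ∀ᶠ y in 𝓝 x, (v t - fun y => -(n : ℝ) * P t y) y = 0 := by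
      have hfr : ∀ᶠ y in 𝓝 x, φ (t, y) = 0 → y ∈ frontier (Om t) :=
        EllipticGrowth.eventually_slice hφ.eventually_mem_frontier
      refine EllipticGrowth.eventually_eq_zero_of_cauchy (ψ := fun y => φ (t, y)) (e := EllipticGrowth.basisVec n)
        (κ := lam * rho) (EllipticGrowth.analyticAt_slice hφ.1)
        (hφ.eq_zero_of_mem_frontier (hOm.isOpen t ht) hx) (EllipticGrowth.exists_dirDeriv_ne_zero hφ.2.1)
        ((hl t ht x hx).mul (hr t ht x hx)) ?_ ((hva t ht x hx).sub hpa) ?_ ?_ fun z => ?_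
      · exact mul_ne_zero (hl0 t ht x hx) (hrho_pos t ht x (frontier_subset_closure hx)).ne'
      · filter_upwards [hvpde t ht x hx, hPpde, (hva t ht x hx).eventually_analyticAt,
          hpa.eventually_analyticAt] with y h1 h2 h3 h4
        rw [EllipticGrowth.expandedOp_sub_apply h3.contDiffAt h4.contDiffAt, EllipticGrowth.expandedOp_const_mul, h1]
        simp [h2]
      · filter_upwards [hfr] with y hy hy0
        obtain ⟨φ', hφ'⟩ := hOm.exists_localDefiningFunction ht (hy hy0)
        simp [(hdata t ht y (hy hy0) φ' hφ').1, hEG.boundary t ht y (hy hy0)]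
      · filter_upwards [hfr, (hva t ht x hx).eventually_analyticAt,
          hpa.eventually_analyticAt] with y hy h3 h4 hy0
        rw [EllipticGrowth.dirDeriv_sub_apply h3.differentiableAt h4.differentiableAt, EllipticGrowth.dirDeriv_const_mul,
          ← EllipticGrowth.inner_gradient, hgradP y (hy hy0), inner_smul_left,
          EllipticGrowth.inner_gradient]
        simp
    filter_upwards [hzero] with y hy
    exact sub_eq_zero.1 hy
  · intro h
    have h' : ∀ t ∈ I, ∀ x ∈ frontier (Om t), v t =ᶠ[𝓝 x] fun y => -(n : ℝ) * P t y :=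
      fun t ht x hx => eventually_nhdsSet_iff_forall.1 (h t ht) x hx
    have hPa : ∀ t ∈ I, ∀ x ∈ frontier (Om t), AnalyticAt ℝ (P t) x := by
      intro t ht x hx
      refine (analyticAt_const (v := -(n : ℝ)⁻¹)).mul (hva t ht x hx) |>.congr ?_
      filter_upwards [h' t ht x hx] with y hy
      simp [hy, hn0]
    refine ⟨hP, fun t ht => ?_, hPa, fun t ht x hx => ?_, fun t ht x hx => ?_⟩
    · have hrank : 1 < Module.rank ℝ (EllipticGrowth.E n) := by
        refine Module.one_lt_rank_of_one_lt_finrank ?_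
        rw [finrank_euclideanSpace_fin]
        omega
      have hcon := EllipticGrowth.isPreconnected_diff_finset hrank (hOm.isOpen t ht)
        (hOm.isConnected t ht).isPreconnected S
      have han : AnalyticOnNhd ℝ (EllipticGrowth.ellipticOp lam rho (P t)) (Om t \ (S : Set (EllipticGrowth.E n))) :=
        fun y hy => EllipticGrowth.analyticAt_ellipticOp ((hP t ht).analytic y hy)
          (hlam t ht y (subset_closure hy.1)) (hrho t ht y (subset_closure hy.1))
      obtain ⟨x, hx⟩ := hOm.frontier_nonempty t ht
      have hnear : ∀ᶠ y in 𝓝 x, EllipticGrowth.ellipticOp lam rho (P t) y = 0 := by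
        filter_upwards [hvpde t ht x hx,
          EllipticGrowth.expandedOp_congr (e := EllipticGrowth.basisVec n) (κ := lam * rho) (h' t ht x hx),
          EllipticGrowth.eventually_ellipticOp_eq (hPa t ht x hx) (hl t ht x hx) (hr t ht x hx)] with y h1 h2 h3
        rw [h1, EllipticGrowth.expandedOp_const_mul] at h2
        rw [h3]
        simpa [hn0] using h2
      -- A point of `Ω_t \ S` close enough to the boundary starts the identity theorem on the
      -- connected set `Ω_t \ S`.
      obtain ⟨y, hy, hy0⟩ := ((EllipticGrowth.frequently_mem_diff_of_mem_frontier (hOm.isOpen t ht)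
        (hP t ht).subset hx).and_eventually hnear.eventually_nhds).exists
      exact han.eqOn_zero_of_preconnected_of_eventuallyEq_zero hcon hy hy0
    · obtain ⟨φ, hφ⟩ := hOm.exists_localDefiningFunction ht hx
      have := (h' t ht x hx).self_of_nhds
      rw [(hdata t ht x hx φ hφ).1] at this
      simpa [hn0] using this.symm
    · obtain ⟨φ, hφ⟩ := hOm.exists_localDefiningFunction ht hx
      refine ⟨φ, hφ, ?_⟩
      have hl0' := hl0 t ht x hx
      have hgrad : gradient (v t) x = (-(n : ℝ)) • gradient (P t) x := by
        ext i
        rw [PiLp.smul_apply, EllipticGrowth.gradient_apply, EllipticGrowth.gradient_apply,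
          (EllipticGrowth.dirDeriv_congr (h' t ht x hx) _).self_of_nhds, EllipticGrowth.dirDeriv_const_mul, smul_eq_mul]
      rw [(hdata t ht x hx φ hφ).2] at hgrad
      rw [← inv_smul_smul₀ (neg_ne_zero.2 hn0) (gradient (P t) x), ← hgrad, smul_smul, smul_smul,
        ← neg_smul]
      congr 1
      field_simp
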